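/- Let $\mathbb{K}$ be an infinite field and let $\mathcal{A}$ be a central hyperplane arrangement of size $m$ in $\mathbb{K}^3$, given by pairwise non-proportional nonzero linear forms $l_1,\ldots,l_m\in R=\mathbb{K}[x,y,z]$. Assume that $\operatorname{char}(\mathbb{K})$ does not divide $m$ and, if $m\ge 4$, that it does not divide $m-1$ either. Put $f=l_1\cdots l_m$, let $J_f\subset R$ be the ideal generated by the partial derivatives $f_x,f_y,f_z$, and let $\mathbb{I}\subset R$ be the ideal generated by the $(m-1)$-fold products $\prod_{j\neq i}l_j$, $1\le i\le m$. Suppose that $\mathcal{A}$ admits a coloop, that is, some $l_i$ such that $\dim_{\mathbb{K}}\operatorname{span}\{l_j : j\neq i\}=\dim_{\mathbb{K}}\operatorname{span}\{l_1,\ldots,l_m\}-1$. Then $J_f$ is a minimal reduction of $\mathbb{I}$: one has $J_f\subseteq\mathbb{I}$ and $J_f\,\mathbb{I}^r=\mathbb{I}^{r+1}$ for some $r\ge 0$, and no ideal of $R$ strictly contained in $J_f$ is a reduction of $\mathbb{I}$ in this sense. -/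

import Mathlib

/-- A central hyperplane arrangement of size `m` in `K ^ n`, given by its defining linear forms:
nonzero homogeneous polynomials of degree `1`, no two of them proportional
(so that they define `m` distinct hyperplanes through the origin). -/
structure IsCentralArrangement {K : Type*} [Field K] {n m : ℕ}
    (l : Fin m → MvPolynomial (Fin n) K) : Prop where
  isHomogeneous : ∀ i, (l i).IsHomogeneous 1
  ne_zero : ∀ i, l i ≠ 0
  pairwise_independent : ∀ i j, i ≠ j → LinearIndependent K ![l i, l j]

/-- The form `l i` is a coloop: the rank of the deletion of `l i` is one less than the rank of the
whole arrangement, the rank being the dimension of the `K`-span of the linear forms. -/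
def IsColoop {K : Type*} [Field K] {n m : ℕ}
    (l : Fin m → MvPolynomial (Fin n) K) (i : Fin m) : Prop :=
  Set.finrank K (l '' {j | j ≠ i}) + 1 = Set.finrank K (Set.range l)

/-- The defining polynomial `f = l₁ ⋯ lₘ` of the arrangement. -/
noncomputable def definingPolynomial {K : Type*} [Field K] {n m : ℕ}
    (l : Fin m → MvPolynomial (Fin n) K) : MvPolynomial (Fin n) K :=
  ∏ i, l i

/-- The Jacobian ideal of `f`, generated by its partial derivatives. -/
noncomputable def jacobianIdeal {K : Type*} [Field K] {n : ℕ}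
    (f : MvPolynomial (Fin n) K) : Ideal (MvPolynomial (Fin n) K) :=
  Ideal.span (Set.range fun j : Fin n => MvPolynomial.pderiv j f)

/-- The ideal generated by the `(m - 1)`-fold products `∏_{j ≠ i} l j`. -/
noncomputable def foldProductIdeal {K : Type*} [Field K] {n m : ℕ}
    (l : Fin m → MvPolynomial (Fin n) K) : Ideal (MvPolynomial (Fin n) K) :=
  Ideal.span (Set.range fun i : Fin m => ∏ j ∈ Finset.univ.erase i, l j)

/-- `J` is a reduction of `I`: `J ⊆ I` and `J I ^ r = I ^ (r + 1)` for some `r`. -/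
def IsReduction {R : Type*} [CommRing R] (J I : Ideal R) : Prop :=
  J ≤ I ∧ ∃ r : ℕ, J * I ^ r = I ^ (r + 1)

/-- `J` is a minimal reduction of `I`: it is a reduction of `I`, and minimal with respect to
inclusion among all ideals that are reductions of `I`. -/
def IsMinimalReduction {R : Type*} [CommRing R] (J I : Ideal R) : Prop :=
  Minimal (fun L : Ideal R => IsReduction L I) J

/-! Let w be the coloop. The remaining forms lie in the plane spanned by two of them, x and y; let g
be their product, so f = w g. With p, q the derivatives of g along x, y, the ideal J_f is (g, wp,
wq) (`IsDeletionCoordinates.jacobianIdeal_eq`). For m ≥ 4, Euler's relation xp + yq = (m-1) g gives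
g = s x p + t y q with s, t nonzero; for m = 3, g = xy and any nonzero s, t with s + t = 1 will do.

Reduction, with r = 1: write f_i = f / l_i. For i ≠ j, neither the coloop, and G = f / (l_i l_j),
one has f_i f_j = w g G = wp (s x G) + wq (t y G). Both xG and yG lie in 𝕀, because x and y are
combinations of l_i and l_j. Squares f_i² then follow modulo J𝕀 by multiplying a suitable
directional derivative of f by f_i.

Minimality: J_f is of linear type, and an ideal of linear type has no proper reductions
(`IsOfLinearType.le_of_mul_pow_eq`), even when tested against a larger 𝕀. Linear type is an
elimination (`exists_eq_of_eval₂_reesEval_eq_zero`): after absorbing s, t into x, y, the relations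
on (xp + yq, wp, wq) are generated by wT - xU - yV and pV - qU. One solves for T after inverting w,
then cancels w using regularity modulo w. Sizes 1 and 2 are direct. -/

/-- The family `a` is of linear type: every polynomial relation of its Rees algebra is generated by
linear relations. -/
def IsOfLinearType {R ι : Type*} [CommRing R] [Fintype ι] (a : ι → R) : Prop :=
  ∀ G : MvPolynomial ι R,
    MvPolynomial.aeval (fun i => Polynomial.C (a i) * Polynomial.X) G = 0 →
    G ∈ Ideal.span {F | ∃ c : ι → R, ∑ i, c i * a i = 0 ∧
      F = ∑ i, MvPolynomial.C (c i) * MvPolynomial.X i}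

/-- To show that a family is of linear type, the polynomial ring in the relations may be replaced by
any ring `B` through which it factors. -/
theorem IsOfLinearType.of_ringHom {R ι B : Type*} [CommRing R] [Fintype ι] [CommRing B] {a : ι → R}
    (j : R →+* B) (t : ι → B) (ε : B →+* Polynomial R) (σ : B →+* MvPolynomial ι R)
    (hεj : ∀ r, ε (j r) = Polynomial.C r) (hεt : ∀ i, ε (t i) = Polynomial.C (a i) * Polynomial.X)
    (hσj : ∀ r, σ (j r) = MvPolynomial.C r) (hσt : ∀ i, σ (t i) = MvPolynomial.X i)
    (h : ∀ F, ε F = 0 → σ F ∈ Ideal.span {F | ∃ c : ι → R, ∑ i, c i * a i = 0 ∧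
      F = ∑ i, MvPolynomial.C (c i) * MvPolynomial.X i}) : IsOfLinearType a := by
  intro G hG
  have hσ : σ.comp (MvPolynomial.eval₂Hom j t) = RingHom.id _ :=
    MvPolynomial.ringHom_ext (by simp [hσj]) (by simp [hσt])
  have hε : ε.comp (MvPolynomial.eval₂Hom j t) = (MvPolynomial.aeval (R := R)
      (fun i => Polynomial.C (a i) * Polynomial.X)).toRingHom :=
    MvPolynomial.ringHom_ext (by simp [hεj]) (by simp [hεt])
  have h1 := h (MvPolynomial.eval₂Hom j t G) ((RingHom.congr_fun hε G).trans hG)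
  rwa [show σ (MvPolynomial.eval₂Hom j t G) = G from RingHom.congr_fun hσ G] at h1

/-! ### Reductions of ideals of linear type -/

/-- Integral dependence on an ideal `L` with `L * I ^ r = I ^ (r + 1)`. -/
theorem exists_monic_of_mul_pow_eq {R : Type*} [CommRing R] [IsDomain R] [IsNoetherianRing R]
    {L I : Ideal R} {r : ℕ} (h : L * I ^ r = I ^ (r + 1)) {b : R} (hb : b ∈ I) :
    ∃ p : Polynomial R, p.Monic ∧ (∀ k, p.coeff k ∈ L ^ (p.natDegree - k)) ∧ p.eval b = 0 := by
  by_cases hI : I = ⊥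
  · subst hI
    refine ⟨Polynomial.X, Polynomial.monic_X, fun k => ?_, by simpa using hb⟩
    rcases Nat.lt_trichotomy k 1 with hk | rfl | hk
    · obtain rfl : k = 0 := by omega
      simp
    · simp
    · simp [Polynomial.coeff_X, hk.ne]
  -- Determinant trick: multiplication by `b` maps `I ^ r` into `I ^ (r + 1) = L * I ^ r`. A nonzero
  -- element of `I ^ r` then turns the operator identity into `p(b) = 0`.
  · obtain ⟨p, hp, -, hc, he⟩ :=
      LinearMap.exists_monic_and_natDegree_eq_and_coeff_mem_pow_and_aeval_eq_zero R
        (M := ↥(I ^ r)) (algebraMap R (Module.End R ↥(I ^ r)) b) L (by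
          rintro _ ⟨x, rfl⟩
          have hx : b * (x : R) ∈ L * I ^ r := by
            rw [h, pow_succ']; exact Ideal.mul_mem_mul hb x.2
          have : Submodule.map (Submodule.subtype (I ^ r)) (L • ⊤) = L * I ^ r := by
            rw [Submodule.map_smul'']; simp
          rw [← this] at hx
          obtain ⟨y, hy, hyx⟩ := hx
          have hxy : (algebraMap R (Module.End R ↥(I ^ r)) b) x = y :=
            Subtype.ext (by simpa using hyx.symm)
          rw [hxy]
          exact hy)
    refine ⟨p, hp, hc, ?_⟩
    obtain ⟨x, hx, hx0⟩ := Submodule.exists_mem_ne_zero_of_ne_bot (pow_ne_zero r hI)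
    rw [Polynomial.aeval_algebraMap_apply] at he
    have h1 := congrArg (fun f => ((f ⟨x, hx⟩ : ↥(I ^ r)) : R)) he
    simp only [Module.algebraMap_end_apply, LinearMap.zero_apply, Submodule.coe_smul,
      smul_eq_mul, ZeroMemClass.coe_zero, mul_eq_zero, hx0, or_false] at h1
    simpa using h1

/-- An element of `L ^ n` is a sum of products of `n` elements of `L`, and each factor lifts to a
linear form vanishing at `t`. For `n = 0` the lift is a constant, which need not vanish. -/
theorem exists_lift_of_mem_pow {R ι k : Type*} [CommRing R] [Fintype ι] [CommRing k] [Algebra R k]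
    {a : ι → R} {t : ι → k} {L : Ideal R}
    (hL : ∀ x ∈ L, ∃ c : ι → R, ∑ i, c i * a i = x ∧ ∑ i, algebraMap R k (c i) * t i = 0)
    (n : ℕ) {x : R} (hx : x ∈ L ^ n) :
    ∃ G : MvPolynomial ι R,
      MvPolynomial.aeval (fun i => Polynomial.C (a i) * Polynomial.X) G
        = Polynomial.C x * Polynomial.X ^ n ∧ (0 < n → MvPolynomial.aeval t G = 0) := by
  induction n generalizing x with
  | zero => exact ⟨MvPolynomial.C x, by simp, by simp⟩
  | succ n ih =>
    rw [pow_succ] at hx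
    refine Submodule.mul_induction_on hx ?_ ?_
    · intro u hu v hv
      obtain ⟨G, hG, -⟩ := ih hu
      obtain ⟨c, hc, hc'⟩ := hL v hv
      refine ⟨G * ∑ i, MvPolynomial.C (c i) * MvPolynomial.X i, ?_, fun _ => ?_⟩
      · simp only [map_mul, hG, map_sum, MvPolynomial.aeval_X, MvPolynomial.aeval_C, ← hc,
          Polynomial.algebraMap_apply, Algebra.algebraMap_self, RingHom.id_apply, ← mul_assoc,
          ← Finset.sum_mul]
        ring
      · simp [hc']
    · rintro u v ⟨G, hG, hG'⟩ ⟨H, hH, hH'⟩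
      exact ⟨G + H, by simp [hG, hH, add_mul], fun h => by simp [hG' h, hH' h]⟩

/-- Points of the Rees algebra that vanish on `L` vanish on everything integral over `L`. -/
theorem IsOfLinearType.eq_zero_of_monic {R ι k : Type*} [CommRing R] [Fintype ι] [CommRing k]
    [IsDomain k] [Algebra R k] {a : ι → R} (ha : IsOfLinearType a) {t : ι → k} {L : Ideal R}
    (ht : ∀ c : ι → R, ∑ i, c i * a i = 0 → ∑ i, algebraMap R k (c i) * t i = 0)
    (hL : ∀ x ∈ L, ∃ c : ι → R, ∑ i, c i * a i = x ∧ ∑ i, algebraMap R k (c i) * t i = 0)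
    {i : ι} {p : Polynomial R} (hp : p.Monic) (hpc : ∀ k, p.coeff k ∈ L ^ (p.natDegree - k))
    (hpe : p.eval (a i) = 0) : t i = 0 := by
  -- Linear type enters here: evaluation at `t` factors through the Rees algebra as soon as it kills
  -- the linear relations.
  have hrel : ∀ G : MvPolynomial ι R,
      MvPolynomial.aeval (fun i => Polynomial.C (a i) * Polynomial.X) G = 0 →
      MvPolynomial.aeval t G = 0 := by
    intro G hG
    rw [← RingHom.mem_ker]
    refine (Ideal.span_le.mpr ?_) (ha G hG)
    rintro _ ⟨c, hc, rfl⟩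
    simpa [RingHom.mem_ker] using ht c hc
  choose G hG hG' using fun k => exists_lift_of_mem_pow hL (p.natDegree - k) (hpc k)
  set n := p.natDegree with hn
  -- The homogenised integral equation of `a i` is a relation of the Rees algebra. At `t` only its
  -- leading term survives, since each `G k` with `k < n` has positive degree.
  have key := hrel (∑ k ∈ Finset.range n, G k * MvPolynomial.X i ^ k + MvPolynomial.X i ^ n) (by
    simp only [map_add, map_sum, map_mul, map_pow, hG, MvPolynomial.aeval_X]
    rw [Polynomial.eval_eq_sum_range, Finset.sum_range_succ, ← hn, hn, hp.coeff_natDegree,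
      ← hn, one_mul] at hpe
    have h2 := congrArg (fun x => Polynomial.C x * Polynomial.X ^ n) hpe
    simp only [map_add, map_sum, map_mul, map_pow, map_zero, zero_mul, add_mul,
      Finset.sum_mul] at h2
    rw [← h2]
    congr 1
    · refine Finset.sum_congr rfl fun k hk => ?_
      have hk := Finset.mem_range.mp hk
      have h3 : n = (n - k) + k := by omega
      conv_rhs => rw [h3, pow_add]
      ring
    · ring)
  simp only [map_add, map_sum, map_mul, map_pow, MvPolynomial.aeval_X] at key
  rw [Finset.sum_eq_zero, zero_add] at key
  · exact eq_zero_of_pow_eq_zero key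
  · intro k hk
    rw [hG' k (by have := Finset.mem_range.mp hk; omega), zero_mul]

/-- An ideal of linear type has no proper reductions. -/
theorem IsOfLinearType.le_of_mul_pow_eq {R ι : Type*} [CommRing R] [IsDomain R]
    [IsNoetherianRing R] [Fintype ι] {a : ι → R} (ha : IsOfLinearType a) {L I : Ideal R} {r : ℕ}
    (hLJ : L ≤ Ideal.span (Set.range a)) (hJI : Ideal.span (Set.range a) ≤ I)
    (h : L * I ^ r = I ^ (r + 1)) : Ideal.span (Set.range a) ≤ L := by
  by_contra hne
  set J := Ideal.span (Set.range a) with hJ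
  -- If `L` were smaller than `J`, some simple quotient `J / N ≅ R / P` would kill `L`. The images
  -- `t i` of the generators give a point of the Rees algebra over the field `R / P`; integrality
  -- over `L` forces them to vanish, contradicting `N ≠ ⊤`.
  obtain ⟨N, hN, hLN⟩ := (eq_top_or_exists_le_coatom (Submodule.comap J.subtype L)).resolve_left
    (by
      intro htop
      apply hne
      intro x hx
      have : (⟨x, hx⟩ : J) ∈ Submodule.comap J.subtype L := htop ▸ Submodule.mem_top
      simpa using this)
  obtain ⟨P, hP, ⟨e⟩⟩ := isSimpleModule_iff_quot_maximal.mp (isSimpleModule_iff_isCoatom.mpr hN)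
  let lam : J →ₗ[R] R ⧸ P := e.toLinearMap ∘ₗ N.mkQ
  have hlamL : ∀ x : J, (x : R) ∈ L → lam x = 0 := by
    intro x hx
    have : N.mkQ x = 0 := by simpa using hLN hx
    simp only [lam, LinearMap.comp_apply, this, map_zero]
  have haJ : ∀ i, a i ∈ J := fun i => Ideal.subset_span ⟨i, rfl⟩
  let t : ι → R ⧸ P := fun i => lam ⟨a i, haJ i⟩
  have hlin : ∀ c : ι → R, ∀ x : J, ∑ i, c i * a i = x →
      ∑ i, algebraMap R (R ⧸ P) (c i) * t i = lam x := by
    intro c x hx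
    have : x = ∑ i, c i • (⟨a i, haJ i⟩ : J) := by
      ext; simp [← hx]
    rw [this, map_sum]
    simp only [map_smul, Algebra.smul_def, t]
  have hP' := Ideal.Quotient.isDomain P
  have ht : ∀ i, t i = 0 := by
    intro i
    obtain ⟨p, hp, hpc, hpe⟩ := exists_monic_of_mul_pow_eq h (hJI (haJ i))
    refine ha.eq_zero_of_monic (fun c hc => ?_) (fun x hx => ?_) hp hpc hpe
    · rw [hlin c 0 hc, map_zero]
    · obtain ⟨c, hc⟩ := (Ideal.mem_span_range_iff_exists_fun).mp (hLJ hx)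
      exact ⟨c, hc, by rw [hlin c ⟨x, hLJ hx⟩ hc]; exact hlamL _ hx⟩
  have hlam0 : ∀ x : J, lam x = 0 := by
    intro x
    obtain ⟨c, hc⟩ := (Ideal.mem_span_range_iff_exists_fun).mp x.2
    rw [← hlin c x hc]
    simp [ht]
  apply hN.1
  rw [eq_top_iff]
  intro x _
  have := hlam0 x
  simpa [lam] using this

/-! ### Elimination in Rees algebras: pairs and triples of linear type -/

open Polynomial in
-- Substitution of `X = e / w` with denominators cleared.
theorem exists_dvd_pow_mul_sub_C {A : Type*} [CommRing A] (w e : A) (G : A[X]) :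
    ∃ (N : ℕ) (H : A), (C w * X - C e) ∣ C (w ^ N) * G - C H := by
  induction G using Polynomial.induction_on with
  | C a => exact ⟨0, a, by simp⟩
  | add p q hp hq =>
    obtain ⟨N, H, α, h⟩ := hp
    obtain ⟨N', H', β, h'⟩ := hq
    refine ⟨N + N', w ^ N' * H + w ^ N * H', C (w ^ N') * α + C (w ^ N) * β, ?_⟩
    simp only [map_add, map_mul, map_pow] at *
    linear_combination C w ^ N' * h + C w ^ N * h'
  | monomial n a h =>
    obtain ⟨N, H, α, h⟩ := h
    refine ⟨N + 1, H * e, C w * X * α + C H, ?_⟩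
    simp only [map_mul, map_pow] at *
    linear_combination C w * X * h

open Polynomial in
theorem exists_dvd_pow_mul_sub_C_of_eval₂_eq_zero {A B : Type*} [CommRing A] [CommRing B] (w e : A)
    {φ : A →+* B} {b : B} (hb : φ w * b = φ e) {G : A[X]} (hG : eval₂ φ b G = 0) :
    ∃ (N : ℕ) (H : A), φ H = 0 ∧ (C w * X - C e) ∣ C (w ^ N) * G - C H := by
  obtain ⟨N, H, α, h⟩ := exists_dvd_pow_mul_sub_C w e G
  refine ⟨N, H, ?_, α, h⟩
  have h1 := congrArg (eval₂RingHom φ b) h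
  simp only [map_sub, map_mul, coe_eval₂RingHom, hG, eval₂_C, eval₂_X, hb] at h1
  linear_combination -h1

open Polynomial in
/-- The evaluation `A[X][Y] → A[S]` sending `X` to `u S` and `Y` to `v S`. -/
noncomputable def reesEval {A : Type*} [CommRing A] (u v : A) : A[X][X] →+* A[X] :=
  eval₂RingHom (compRingHom (C u * X)) (C v * X)

section reesEval

open Polynomial

variable {A : Type*} [CommRing A] (u v : A)

theorem reesEval_X : reesEval u v X = C v * X := by simp [reesEval]

theorem reesEval_C_X : reesEval u v (C X) = C u * X := by simp [reesEval]

theorem reesEval_C_C (a : A) : reesEval u v (C (C a)) = C a := by simp [reesEval]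

end reesEval

open Polynomial in
/-- The relations between the two generators of the Rees algebra of a regular sequence. -/
theorem dvd_of_reesEval_eq_zero {A : Type*} [CommRing A] [IsDomain A] {u v : A} (hu : u ≠ 0)
    (huv : ∀ c, u ∣ v * c → u ∣ c) {F : A[X][X]} (hF : reesEval u v F = 0) :
    (C (C u) * X - C (C v) * C X) ∣ F := by
  -- Comparing coefficients one degree higher in the inner variable shows that `u` divides `v` times
  -- each coefficient of `α`, so regularity allows `u` to be cancelled.
  have hcancel : ∀ G α : A[X][X], C (C u) * G = (C (C u) * X - C (C v) * C X) * α →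
      (C (C u) * X - C (C v) * C X) ∣ G := by
    intro G α h
    have hα : C (C u) ∣ α := by
      rw [C_dvd_iff_dvd_coeff]
      intro i
      rw [C_dvd_iff_dvd_coeff]
      intro j
      apply huv
      have h1 := congrArg (fun p : A[X][X] => (p.coeff i).coeff (j + 1)) h
      cases i with
      | zero =>
        simp only [sub_mul, mul_assoc, coeff_C_mul, coeff_sub, coeff_X_mul, coeff_X_mul_zero,
          mul_zero, coeff_zero] at h1
        exact ⟨-(G.coeff 0).coeff (j + 1), by linear_combination h1⟩
      | succ i =>
        simp only [sub_mul, mul_assoc, coeff_C_mul, coeff_sub, coeff_X_mul] at h1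
        exact ⟨(α.coeff i).coeff (j + 1) - (G.coeff (i + 1)).coeff (j + 1), by
          linear_combination h1⟩
    obtain ⟨β, rfl⟩ := hα
    refine ⟨β, mul_left_cancel₀ (a := C (C u)) (by simpa using hu) ?_⟩
    rw [h]; ring
  have hcancel' : ∀ (N : ℕ) (G : A[X][X]), (C (C u) * X - C (C v) * C X) ∣ C (C u) ^ N * G →
      (C (C u) * X - C (C v) * C X) ∣ G := by
    intro N
    induction N with
    | zero => intro G h; simpa using h
    | succ N ih =>
      intro G h
      refine ih G ?_
      obtain ⟨α, h⟩ := h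
      exact hcancel _ α (by rw [← h]; ring)
  obtain ⟨N, H, α, h⟩ := exists_dvd_pow_mul_sub_C (C u) (C v * X) F
  have hH : H = 0 := by
    have h1 := congrArg (reesEval u v) h
    have h2 : reesEval u v (C H) = H.comp (C u * X) := by simp [reesEval]
    simp only [map_sub, map_mul, hF, reesEval_X, reesEval_C_X, reesEval_C_C, h2] at h1
    have h3 : H.comp (C u * X) = 0 := by linear_combination -h1
    exact (comp_C_mul_X_eq_zero_iff (mem_nonZeroDivisors_of_ne_zero hu)).mp h3
  apply hcancel' N
  subst hH
  refine ⟨α, ?_⟩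
  simp only [map_mul, map_pow, map_zero, sub_zero] at h
  rw [h]

open Polynomial in
/-- A pair `u, v` with `v` regular modulo `u` is of linear type. -/
theorem isOfLinearType_pair {A : Type*} [CommRing A] [IsDomain A] {u v : A} (hu : u ≠ 0)
    (huv : ∀ c, u ∣ v * c → u ∣ c) : IsOfLinearType ![u, v] := by
  refine IsOfLinearType.of_ringHom (C.comp C) ![C X, X] (reesEval u v)
    (eval₂RingHom (eval₂RingHom MvPolynomial.C (MvPolynomial.X 0)) (MvPolynomial.X 1))
    ?_ ?_ ?_ ?_ ?_
  · simp [reesEval_C_C]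
  · simp [Fin.forall_fin_succ, reesEval_X, reesEval_C_X]
  · simp
  · simp [Fin.forall_fin_succ]
  intro F hF
  obtain ⟨α, rfl⟩ := dvd_of_reesEval_eq_zero hu huv hF
  rw [map_mul]
  refine Ideal.mul_mem_right _ _ (Ideal.subset_span ⟨![-v, u], ?_, ?_⟩)
  · simp; ring
  · simp; ring

open Polynomial in
/-- If `e` is regular and `f` is regular modulo `e` after reduction modulo `w`, then `w` is regular
modulo `w X - e` and `f`. -/
theorem exists_eq_of_C_mul_eq {A k : Type*} [CommRing A] [IsDomain A] [CommRing k] [IsDomain k]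
    {w e f : A} (hw : w ≠ 0) {π : A →+* k} (hπs : Function.Surjective π)
    (hπ : ∀ r, π r = 0 ↔ w ∣ r) (he : π e ≠ 0) (hef : ∀ a b, π e * a = π f * b → π e ∣ b)
    {G α β : A[X]} (h : C w * G = (C w * X - C e) * α + C f * β) :
    ∃ α' β', G = (C w * X - C e) * α' + C f * β' := by
  let μ : A[X] →+* k[X] := mapRingHom π
  have hμs : Function.Surjective μ := map_surjective _ hπs
  have hμC : ∀ a, μ (C a) = C (π a) := fun a => by simp [μ]
  have hμ : ∀ z, μ z = 0 → ∃ z', z = C w * z' := by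
    intro z hz
    change C w ∣ z
    rw [C_dvd_iff_dvd_coeff]
    intro i
    rw [← hπ]
    simpa [μ] using congrArg (fun f : k[X] => f.coeff i) hz
  have hπw : π w = 0 := (hπ w).mpr dvd_rfl
  have h1 : C (π e) * μ α = C (π f) * μ β := by
    have := congrArg μ h
    simp only [map_mul, map_add, map_sub, hμC, hπw, map_zero, zero_mul, zero_sub] at this
    linear_combination this
  obtain ⟨γ, hγ⟩ : C (π e) ∣ μ β := by
    rw [C_dvd_iff_dvd_coeff]
    intro i
    refine hef ((μ α).coeff i) _ ?_
    simpa only [coeff_C_mul] using congrArg (fun z => coeff z i) h1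
  obtain ⟨γ, rfl⟩ := hμs γ
  have hα : μ α = C (π f) * μ γ := by
    apply mul_left_cancel₀ (a := C (π e)) (by simpa using he)
    rw [h1, hγ]; ring
  obtain ⟨α', hα'⟩ := hμ (α - C f * γ) (by rw [map_sub, hα, map_mul, hμC, sub_self])
  obtain ⟨β', hβ'⟩ := hμ (β - C e * γ) (by rw [map_sub, hγ, map_mul, hμC, sub_self])
  -- With `α = w α' + f γ` and `β = w β' + e γ`, the terms `e f γ` cancel and the surviving `w X f
  -- γ` moves into the coefficient of `f`.
  refine ⟨α', γ * X + β', mul_left_cancel₀ (a := C w) (by simpa using hw) ?_⟩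
  rw [h, sub_eq_iff_eq_add.mp hα', sub_eq_iff_eq_add.mp hβ']
  ring

open Polynomial in
theorem exists_eq_of_C_pow_mul_eq {A k : Type*} [CommRing A] [IsDomain A] [CommRing k] [IsDomain k]
    {w e f : A} (hw : w ≠ 0) {π : A →+* k} (hπs : Function.Surjective π)
    (hπ : ∀ r, π r = 0 ↔ w ∣ r) (he : π e ≠ 0) (hef : ∀ a b, π e * a = π f * b → π e ∣ b)
    (N : ℕ) {G α β : A[X]} (h : C (w ^ N) * G = (C w * X - C e) * α + C f * β) :
    ∃ α' β', G = (C w * X - C e) * α' + C f * β' := by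
  induction N generalizing G α β with
  | zero => exact ⟨α, β, by simpa using h⟩
  | succ N ih =>
    obtain ⟨α', β', h'⟩ := exists_eq_of_C_mul_eq hw hπs hπ he hef (G := C (w ^ N) * G) (by
      rw [← h, pow_succ, map_mul]; ring)
    exact ih h'

open Polynomial in
/-- The relations between `x p + y q`, `w p` and `w q`. -/
theorem exists_eq_of_eval₂_reesEval_eq_zero {R : Type*} [CommRing R] [IsDomain R] {w x y p q : R}
    (hw : Prime w) (hy : ¬ w ∣ y) (hxy : ∀ c e, w ∣ x * c - y * e → ∃ d, w ∣ c - y * d)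
    (hg : ¬ w ∣ x * p + y * q) (hp : p ≠ 0) (hpq : ∀ c, p ∣ q * c → p ∣ c) {F : R[X][X][X]}
    (hF : eval₂ (reesEval (w * p) (w * q)) (C (x * p + y * q) * X) F = 0) :
    ∃ α β, F = (C (C (C w)) * X - C (C (C x) * C X + C (C y) * X)) * α
      + C (C (C p) * X - C (C q) * C X) * β := by
  let k := R ⧸ Ideal.span {w}
  have : (Ideal.span {w}).IsPrime := (Ideal.span_singleton_prime hw.ne_zero).mpr hw
  have hk : IsDomain k := Ideal.Quotient.isDomain _
  let π : R →+* k := Ideal.Quotient.mk _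
  have hπ : ∀ r, π r = 0 ↔ w ∣ r := fun r => Ideal.Quotient.eq_zero_iff_dvd w r
  have hπs : Function.Surjective π := Ideal.Quotient.mk_surjective
  let μ : R[X][X] →+* k[X][X] := mapRingHom (mapRingHom π)
  have hμs : Function.Surjective μ := map_surjective _ (map_surjective _ hπs)
  have hμ : ∀ z, μ z = 0 ↔ C (C w) ∣ z := by
    intro z
    simp only [C_dvd_iff_dvd_coeff, ← hπ, Polynomial.ext_iff, μ]
    simp
  -- The outer variable is eliminated, leaving a relation `H` on `w p, w q` alone. It is also a
  -- relation on `p, q`, because rescaling the Rees variable by `w` is injective.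
  obtain ⟨N, H, hH0, α, h⟩ := exists_dvd_pow_mul_sub_C_of_eval₂_eq_zero (C (C w))
    (C (C x) * C X + C (C y) * X) (by
      simp only [map_mul, map_add, reesEval_X, reesEval_C_X, reesEval_C_C]; ring) hF
  have hH : reesEval p q H = 0 := by
    have h4 : (compRingHom (C w * X)).comp (reesEval p q) = reesEval (w * p) (w * q) := by
      ext : 1
      · ext : 1
        · ext a : 1
          simp [reesEval_C_C]
        · simp [reesEval_C_X]; ring
      · simp [reesEval_X]; ring
    have h5 : (reesEval p q H).comp (C w * X) = 0 := by
      change ((compRingHom (C w * X)).comp (reesEval p q)) H = 0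
      rw [h4]
      exact hH0
    exact (comp_C_mul_X_eq_zero_iff (mem_nonZeroDivisors_of_ne_zero hw.ne_zero)).mp h5
  obtain ⟨β, hβ⟩ := dvd_of_reesEval_eq_zero hp hpq hH
  have hμe : μ (C (C x) * C X + C (C y) * X) = C (C (π x)) * C X + C (C (π y)) * X := by
    simp [μ]
  have hμf : μ (C (C p) * X - C (C q) * C X) = C (C (π p)) * X - C (C (π q)) * C X := by
    simp [μ]
  refine exists_eq_of_C_pow_mul_eq (A := R[X][X]) (k := k[X][X]) (π := μ)
    (by simpa using hw.ne_zero) hμs hμ ?_ ?_ N (α := α) (β := C β) ?_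
  · rw [hμe]
    intro h0
    have := congrArg (fun z : k[X][X] => (z.coeff 1).coeff 0) h0
    simp only [coeff_add, coeff_C_mul, ← map_mul, coeff_C_succ, coeff_X_one, mul_one, coeff_C_zero,
      zero_add, coeff_zero] at this
    exact hy ((hπ y).mp this)
  · intro a b hab
    rw [hμe, hμf] at hab
    -- Evaluation at `(y, -x)` kills `x U + y V` and sends `p V - q U` to a nonzero multiple of `x p
    -- + y q` modulo `w`. Hence `b` is a relation on the regular pair `(y, -x)`.
    have h3 := congrArg (reesEval (π y) (-π x)) hab
    have he : reesEval (π y) (-π x) (C (C (π x)) * C X + C (C (π y)) * X) = 0 := by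
      simp only [map_add, map_mul, reesEval_X, reesEval_C_X, reesEval_C_C, map_neg]
      ring
    have hf : reesEval (π y) (-π x) (C (C (π p)) * X - C (C (π q)) * C X)
        = C (-π (x * p + y * q)) * X := by
      simp only [map_add, map_sub, map_mul, reesEval_X, reesEval_C_X, reesEval_C_C, map_neg]
      ring
    rw [map_mul, map_mul, he, hf, zero_mul, eq_comm, mul_eq_zero] at h3
    have hg' : C (-π (x * p + y * q)) ≠ 0 := by rwa [Ne, C_eq_zero, neg_eq_zero, hπ]
    have h4 := h3.resolve_left (mul_ne_zero hg' X_ne_zero)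
    have h5 := dvd_of_reesEval_eq_zero (by simpa [hπ] using hy) (by
      intro c
      obtain ⟨c, rfl⟩ := hπs c
      rintro ⟨d, hd⟩
      obtain ⟨d, rfl⟩ := hπs d
      obtain ⟨b, hb⟩ := hxy c (-d) ((hπ _).mp (by
        simp only [map_sub, map_mul, map_neg]; linear_combination -hd))
      refine ⟨π b, ?_⟩
      have := (hπ _).mpr hb
      rw [map_sub, map_mul] at this
      linear_combination this) h4
    rw [hμe]
    convert h5 using 1
    simp only [map_neg]
    ring
  · rw [sub_eq_iff_eq_add, hβ, map_mul] at h
    exact h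

open Polynomial in
theorem isOfLinearType_triple {R : Type*} [CommRing R] [IsDomain R] {w x y p q : R}
    (hw : Prime w) (hy : ¬ w ∣ y) (hxy : ∀ c e, w ∣ x * c - y * e → ∃ d, w ∣ c - y * d)
    (hg : ¬ w ∣ x * p + y * q) (hp : p ≠ 0) (hpq : ∀ c, p ∣ q * c → p ∣ c) :
    IsOfLinearType ![x * p + y * q, w * p, w * q] := by
  refine IsOfLinearType.of_ringHom (B := R[X][X][X]) (C.comp (C.comp C)) ![X, C (C X), C X]
    (eval₂RingHom (reesEval (w * p) (w * q)) (C (x * p + y * q) * X))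
    (eval₂RingHom (eval₂RingHom (eval₂RingHom MvPolynomial.C (MvPolynomial.X 1))
      (MvPolynomial.X 2)) (MvPolynomial.X 0)) ?_ ?_ ?_ ?_ ?_
  · simp [reesEval_C_C]
  · simp [Fin.forall_fin_succ, reesEval_X, reesEval_C_X]
  · simp
  · simp [Fin.forall_fin_succ]
  intro F hF
  obtain ⟨α, β, rfl⟩ := exists_eq_of_eval₂_reesEval_eq_zero hw hy hxy hg hp hpq hF
  rw [map_add, map_mul, map_mul]
  refine Ideal.add_mem _ (Ideal.mul_mem_right _ _ (Ideal.subset_span ⟨![w, -x, -y], ?_, ?_⟩))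
    (Ideal.mul_mem_right _ _ (Ideal.subset_span ⟨![0, -q, p], ?_, ?_⟩))
  · simp [Fin.sum_univ_three]; ring
  · simp [Fin.sum_univ_three]; ring
  · simp [Fin.sum_univ_three]; ring
  · simp [Fin.sum_univ_three]; ring

/-! ### Linear forms, fold products and directional derivatives -/

open MvPolynomial in
theorem prime_of_isHomogeneous_one {K σ : Type*} [Field K] {l : MvPolynomial σ K}
    (hl : l.IsHomogeneous 1) (h0 : l ≠ 0) : Prime l := by
  refine (irreducible_of_totalDegree_eq_one (hl.totalDegree h0) fun x hx => ?_).prime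
  obtain ⟨i, hi⟩ := MvPolynomial.ne_zero_iff.mp h0
  refine IsUnit.mk0 x fun hx0 => hi ?_
  simpa [hx0] using hx i

open MvPolynomial in
theorem not_dvd_of_linearIndependent {K σ : Type*} [Field K] {l l' : MvPolynomial σ K}
    (hl : l.IsHomogeneous 1) (hl' : l'.IsHomogeneous 1) (h : LinearIndependent K ![l, l']) :
    ¬ l ∣ l' := by
  rintro ⟨u, hu⟩
  have h0 : l ≠ 0 := h.ne_zero 0
  have h0' : l' ≠ 0 := h.ne_zero 1
  have hu0 : u ≠ 0 := by rintro rfl; exact h0' (by simpa using hu)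
  have hdeg := congrArg totalDegree hu
  rw [totalDegree_mul_of_isDomain h0 hu0, hl.totalDegree h0, hl'.totalDegree h0'] at hdeg
  have hu' := totalDegree_eq_zero_iff_eq_C.mp (show u.totalDegree = 0 by omega)
  have := LinearIndependent.pair_iff.mp h (coeff 0 u) (-1) (by
    rw [hu, hu', smul_eq_C_mul]; simp; ring)
  simp at this

/-- A linear functional with prescribed values on a linearly independent family. -/
theorem LinearIndependent.exists_linearMap_apply_eq {K V ι : Type*} [Field K] [AddCommGroup V]
    [Module K V] {v : ι → V} (hv : LinearIndependent K v) (c : ι → K) :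
    ∃ θ : V →ₗ[K] K, ∀ i, θ (v i) = c i := by
  obtain ⟨θ, hθ⟩ := ((Module.Basis.span hv).constr K c).exists_extend
  refine ⟨θ, fun i => ?_⟩
  have h := LinearMap.congr_fun hθ (Module.Basis.span hv i)
  rw [Module.Basis.constr_basis] at h
  rw [← h]
  simp [Module.Basis.span_apply]

theorem Derivation.finset_prod {K A ι : Type*} [CommRing K] [CommRing A] [Algebra K A]
    [DecidableEq ι] (D : Derivation K A A) (s : Finset ι) (f : ι → A) :
    D (∏ i ∈ s, f i) = ∑ i ∈ s, D (f i) * ∏ j ∈ s.erase i, f j := by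
  induction s using Finset.induction_on with
  | empty => simp
  | insert a s ha ih =>
    rw [Finset.prod_insert ha, Derivation.leibniz, ih, Finset.sum_insert ha,
      Finset.erase_insert ha, smul_eq_mul, smul_eq_mul, Finset.mul_sum, add_comm, mul_comm (D _)]
    congr 1
    refine Finset.sum_congr rfl fun i hi => ?_
    have hia : a ≠ i := fun h => ha (h ▸ hi)
    rw [Finset.erase_insert_of_ne hia, Finset.prod_insert (by simp [ha])]
    ring

section Arrangement

variable {K : Type*} [Field K] {n m : ℕ}

open MvPolynomial

/-- The product of all the forms but `l i`. -/
noncomputable def foldProduct (l : Fin m → MvPolynomial (Fin n) K) (i : Fin m) :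
    MvPolynomial (Fin n) K :=
  ∏ j ∈ Finset.univ.erase i, l j

theorem foldProductIdeal_eq (l : Fin m → MvPolynomial (Fin n) K) :
    foldProductIdeal l = Ideal.span (Set.range (foldProduct l)) := rfl

theorem foldProduct_mem (l : Fin m → MvPolynomial (Fin n) K) (i : Fin m) :
    foldProduct l i ∈ foldProductIdeal l := Ideal.subset_span ⟨i, rfl⟩

theorem mul_foldProduct (l : Fin m → MvPolynomial (Fin n) K) (i : Fin m) :
    l i * foldProduct l i = definingPolynomial l :=
  Finset.mul_prod_erase _ _ (Finset.mem_univ i)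

theorem derivation_definingPolynomial (l : Fin m → MvPolynomial (Fin n) K)
    (D : Derivation K (MvPolynomial (Fin n) K) (MvPolynomial (Fin n) K)) :
    D (definingPolynomial l) = ∑ i, D (l i) * foldProduct l i :=
  D.finset_prod _ _

theorem jacobianIdeal_le_foldProductIdeal (l : Fin m → MvPolynomial (Fin n) K) :
    jacobianIdeal (definingPolynomial l) ≤ foldProductIdeal l := by
  refine Ideal.span_le.mpr ?_
  rintro _ ⟨i, rfl⟩
  simp only [derivation_definingPolynomial]
  exact Ideal.sum_mem _ fun j _ => Ideal.mul_mem_left _ _ (foldProduct_mem l j)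

theorem mem_span_range_X {l : MvPolynomial (Fin n) K} (hl : l.IsHomogeneous 1) :
    l ∈ Submodule.span K (Set.range (X : Fin n → MvPolynomial (Fin n) K)) := by
  rw [← homogeneousSubmodule_one_eq_span_X]
  exact (mem_homogeneousSubmodule 1 l).mpr hl

/-- On linear forms `θ` acts as the directional derivative `∑ θ(X k) ∂ₖ`, so the sum is that
derivative of the defining polynomial. -/
theorem sum_functional_mul_foldProduct_mem {l : Fin m → MvPolynomial (Fin n) K}
    (hl : ∀ i, (l i).IsHomogeneous 1) (θ : MvPolynomial (Fin n) K →ₗ[K] K) :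
    ∑ i, C (θ (l i)) * foldProduct l i ∈ jacobianIdeal (definingPolynomial l) := by
  have hθ : ∀ l : MvPolynomial (Fin n) K, l.IsHomogeneous 1 →
      C (θ l) = ∑ k, C (θ (X k)) * pderiv k l := by
    intro l hl
    obtain ⟨c, rfl⟩ := (Submodule.mem_span_range_iff_exists_fun K).mp (mem_span_range_X hl)
    simp [pderiv_X, Pi.single_apply]
    simp [smul_eq_C_mul]
  have : ∑ i, C (θ (l i)) * foldProduct l i
      = ∑ k, C (θ (X k)) * pderiv k (definingPolynomial l) := by
    simp only [derivation_definingPolynomial, Finset.mul_sum]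
    rw [Finset.sum_comm]
    refine Finset.sum_congr rfl fun i _ => ?_
    rw [hθ _ (hl i), Finset.sum_mul]
    simp only [mul_assoc]
  rw [this]
  exact Ideal.sum_mem _ fun k _ => Ideal.mul_mem_left _ _ (Ideal.subset_span ⟨k, rfl⟩)

theorem jacobianIdeal_eq_of_linearIndependent {l : Fin m → MvPolynomial (Fin n) K}
    (hl : ∀ i, (l i).IsHomogeneous 1) (hli : LinearIndependent K l) :
    jacobianIdeal (definingPolynomial l) = foldProductIdeal l := by
  refine le_antisymm (jacobianIdeal_le_foldProductIdeal l) (Ideal.span_le.mpr ?_)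
  rintro _ ⟨i, rfl⟩
  obtain ⟨θ, hθ⟩ := hli.exists_linearMap_apply_eq (Pi.single i 1)
  have := sum_functional_mul_foldProduct_mem hl θ
  simpa [hθ, Pi.single_apply, ite_mul, foldProduct] using this

/-- For coordinates `w, x, y`, the form `x` is regular modulo `w` and `y`. -/
theorem exists_dvd_sub_of_dvd_sub {w x y : MvPolynomial (Fin n) K}
    (hx : x.IsHomogeneous 1) (hy : y.IsHomogeneous 1) (hw : w.IsHomogeneous 1)
    (hli : LinearIndependent K ![w, x, y])
    (hX : ∀ i, (X i : MvPolynomial (Fin n) K) ∈ Submodule.span K (Set.range ![w, x, y]))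
    {c e : MvPolynomial (Fin n) K} (h : w ∣ x * c - y * e) : ∃ d, w ∣ c - y * d := by
  obtain ⟨θ, hθ⟩ := hli.exists_linearMap_apply_eq ![0, 1, 0]
  have hθw : θ w = 0 := hθ 0
  have hθx : θ x = 1 := hθ 1
  have hθy : θ y = 0 := hθ 2
  -- Projection onto the `x`-axis, killing `w` and `y` and congruent to the identity modulo `(w,
  -- y)`. Applied to the divisibility it gives `x * ρ c = 0`, so `c` lies in `(w, y)`.
  let ρ : MvPolynomial (Fin n) K →ₐ[K] MvPolynomial (Fin n) K := aeval fun i => C (θ (X i)) * x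
  have hρ : ∀ l : MvPolynomial (Fin n) K, l.IsHomogeneous 1 → ρ l = C (θ l) * x := by
    intro l hl
    obtain ⟨c, rfl⟩ := (Submodule.mem_span_range_iff_exists_fun K).mp (mem_span_range_X hl)
    simp [ρ, Finset.sum_mul]
    simp [smul_eq_C_mul, mul_assoc]
  have hsub : ∀ r, r - ρ r ∈ Ideal.span {w, y} := by
    intro r
    have h1 : (Ideal.Quotient.mkₐ K (Ideal.span {w, y})).comp ρ
        = Ideal.Quotient.mkₐ K (Ideal.span {w, y}) := by
      refine MvPolynomial.algHom_ext fun i => ?_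
      obtain ⟨a, ha⟩ := (Submodule.mem_span_range_iff_exists_fun K).mp (hX i)
      simp only [Fin.sum_univ_three, Matrix.cons_val_zero, Matrix.cons_val_one,
        Matrix.cons_val] at ha
      have h2 : θ (X i) = a 1 := by
        rw [← ha]; simp [hθw, hθx, hθy]
      refine (Ideal.Quotient.eq.mpr ?_).symm
      change X i - ρ (X i) ∈ _
      rw [hρ _ (isHomogeneous_X K i), h2, ← ha]
      refine Ideal.mem_span_pair.mpr ⟨C (a 0), C (a 2), ?_⟩
      simp only [smul_eq_C_mul]
      ring
    exact Ideal.Quotient.eq.mp (AlgHom.congr_fun h1 r).symm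
  obtain ⟨z, hz⟩ := h
  have h1 := congrArg ρ hz
  simp only [map_sub, map_mul, hρ _ hx, hρ _ hy, hρ _ hw, hθw, hθx, hθy, map_one, map_zero,
    one_mul, zero_mul, sub_zero, mul_eq_zero] at h1
  have hc := hsub c
  rw [h1.resolve_left (hli.ne_zero 1), sub_zero] at hc
  obtain ⟨a, b, hab⟩ := Ideal.mem_span_pair.mp hc
  exact ⟨b, a, by rw [← hab]; ring⟩

end Arrangement

/-! ### Rank consequences of a coloop -/

section Rank

variable {K : Type*} [Field K] {m : ℕ}

open MvPolynomial

theorem finrank_span_range_X (n : ℕ) :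
    Set.finrank K (Set.range (X : Fin n → MvPolynomial (Fin n) K)) ≤ n :=
  (finrank_range_le_card _).trans (by simp)

/-- In a rank 3 arrangement with a coloop, the other forms lie in a plane. -/
theorem mem_span_pair_of_isColoop {l : Fin m → MvPolynomial (Fin 3) K}
    (hl : IsCentralArrangement l) {c : Fin m} (hc : IsColoop l c) {i j : Fin m} (hi : i ≠ c)
    (hj : j ≠ c) (hij : i ≠ j) {k : Fin m} (hk : k ≠ c) :
    l k ∈ Submodule.span K (Set.range ![l i, l j]) := by
  have : FiniteDimensional K
      (Submodule.span K (Set.range (X : Fin 3 → MvPolynomial (Fin 3) K))) :=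
    FiniteDimensional.span_of_finite K (Set.toFinite _)
  have hT : Set.finrank K (Set.range l) ≤ 3 := by
    refine le_trans (Submodule.finrank_mono (Submodule.span_le.mpr ?_)) (finrank_span_range_X 3)
    rintro _ ⟨i, rfl⟩
    exact mem_span_range_X (hl.isHomogeneous i)
  have h2 := finrank_span_eq_card (hl.pairwise_independent i j hij)
  have hle : Submodule.span K (Set.range ![l i, l j]) ≤ Submodule.span K (l '' {j | j ≠ c}) := by
    refine Submodule.span_mono ?_
    rintro _ ⟨k, rfl⟩
    fin_cases k
    · exact ⟨i, hi, rfl⟩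
    · exact ⟨j, hj, rfl⟩
  have : FiniteDimensional K (Submodule.span K (l '' {j | j ≠ c})) :=
    FiniteDimensional.span_of_finite K (Set.toFinite _)
  rw [Submodule.eq_of_le_of_finrank_le hle]
  · exact Submodule.subset_span ⟨k, hk, rfl⟩
  · rw [h2, Fintype.card_fin]
    change Set.finrank K (l '' {j | j ≠ c}) ≤ 2
    unfold IsColoop at hc
    omega

theorem linearIndependent_of_isColoop {l : Fin m → MvPolynomial (Fin 3) K}
    (hl : IsCentralArrangement l) {c : Fin m} (hc : IsColoop l c) {i j : Fin m} (hi : i ≠ c)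
    (hj : j ≠ c) (hij : i ≠ j) : LinearIndependent K ![l c, l i, l j] := by
  refine linearIndependent_finCons.mpr ⟨hl.pairwise_independent i j hij, fun hmem => ?_⟩
  have hle : Submodule.span K (Set.range ![l i, l j]) ≤ Submodule.span K (l '' {j | j ≠ c}) := by
    refine Submodule.span_mono ?_
    rintro _ ⟨k, rfl⟩
    fin_cases k
    · exact ⟨i, hi, rfl⟩
    · exact ⟨j, hj, rfl⟩
  have : Submodule.span K (Set.range l) = Submodule.span K (l '' {j | j ≠ c}) := by
    refine le_antisymm (Submodule.span_le.mpr ?_) (Submodule.span_mono (Set.image_subset_range _ _))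
    rintro _ ⟨k, rfl⟩
    by_cases hk : k = c
    · subst hk; exact hle hmem
    · exact Submodule.subset_span ⟨k, hk, rfl⟩
  unfold IsColoop Set.finrank at hc
  rw [this] at hc
  omega

theorem X_mem_span_of_linearIndependent {v : Fin 3 → MvPolynomial (Fin 3) K}
    (hv : ∀ i, (v i).IsHomogeneous 1) (hli : LinearIndependent K v) (i : Fin 3) :
    (X i : MvPolynomial (Fin 3) K) ∈ Submodule.span K (Set.range v) := by
  have : FiniteDimensional K
      (Submodule.span K (Set.range (X : Fin 3 → MvPolynomial (Fin 3) K))) :=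
    FiniteDimensional.span_of_finite K (Set.toFinite _)
  rw [Submodule.eq_of_le_of_finrank_le (Submodule.span_le.mpr ?_ :
    Submodule.span K (Set.range v) ≤
      Submodule.span K (Set.range (X : Fin 3 → MvPolynomial (Fin 3) K)))]
  · exact Submodule.subset_span ⟨i, rfl⟩
  · rw [finrank_span_eq_card hli, Fintype.card_fin]
    exact finrank_span_range_X 3
  · rintro _ ⟨i, rfl⟩
    exact mem_span_range_X (hv i)

end Rank

theorem IsOfLinearType.isMinimalReduction {R ι : Type*} [CommRing R] [IsDomain R]
    [IsNoetherianRing R] [Fintype ι] {a : ι → R} (ha : IsOfLinearType a) {I : Ideal R}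
    (h : IsReduction (Ideal.span (Set.range a)) I) :
    IsMinimalReduction (Ideal.span (Set.range a)) I :=
  ⟨h, fun _ ⟨_, _, hr⟩ hLJ => ha.le_of_mul_pow_eq hLJ h.1 hr⟩

theorem IsReduction.refl {R : Type*} [CommRing R] (I : Ideal R) : IsReduction I I :=
  ⟨le_rfl, 0, by simp⟩

section Partial

variable {K : Type*} [Field K] {m : ℕ}

open MvPolynomial

/-- A linear combination of the maximal subproducts of `∏ j ∈ S, l j` which is divisible by `l i`
does not involve the subproduct omitting `l i`. -/
theorem coeff_eq_zero_of_dvd_sum {n : ℕ} {l : Fin m → MvPolynomial (Fin n) K}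
    (hl : IsCentralArrangement l) {S : Finset (Fin m)} {i : Fin m} (hi : i ∈ S) {γ : Fin m → K}
    (h : l i ∣ ∑ k ∈ S, C (γ k) * ∏ j ∈ S.erase k, l j) : γ i = 0 := by
  have hp := prime_of_isHomogeneous_one (hl.isHomogeneous i) (hl.ne_zero i)
  -- Every summand with `k ≠ i` still contains the factor `l i`, so `l i` must divide the remaining
  -- one, whose factors are non-proportional to it.
  rw [← Finset.add_sum_erase _ _ hi, dvd_add_left (Finset.dvd_sum fun k hk => ?_)] at h
  · by_contra hγ
    rcases hp.dvd_or_dvd h with h | h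
    · refine hp.not_isUnit (isUnit_of_dvd_unit h ?_)
      exact (isUnit_iff_ne_zero.mpr hγ).map C
    · obtain ⟨j, hj, hij⟩ := (hp.dvd_finsetProd_iff _).mp h
      exact not_dvd_of_linearIndependent (hl.isHomogeneous i) (hl.isHomogeneous j)
        (hl.pairwise_independent i j (Finset.ne_of_mem_erase hj).symm) hij
  · refine Dvd.dvd.mul_left (Finset.dvd_prod_of_mem l ?_) _
    exact Finset.mem_erase.mpr ⟨(Finset.ne_of_mem_erase hk).symm, hi⟩

end Partial

/-! ### The Jacobian ideal in coordinates adapted to the coloop -/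

section Coloop

variable {K : Type*} [Field K] {m : ℕ}

open MvPolynomial

/-- The product of the forms other than `l c` and `l i`. -/
noncomputable def deletionFoldProduct (l : Fin m → MvPolynomial (Fin 3) K) (c i : Fin m) :
    MvPolynomial (Fin 3) K :=
  ∏ j ∈ (Finset.univ.erase c).erase i, l j

/-- The combination of the products `deletionFoldProduct l c i` with coefficients `α`; for suitable
`α` these are the directional derivatives of the deletion. -/
noncomputable def deletionCombination (l : Fin m → MvPolynomial (Fin 3) K) (c : Fin m)
    (α : Fin m → K) : MvPolynomial (Fin 3) K :=
  ∑ k ∈ Finset.univ.erase c, C (α k) * deletionFoldProduct l c k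

theorem mul_deletionFoldProduct (l : Fin m → MvPolynomial (Fin 3) K) {c i : Fin m} (hi : i ≠ c) :
    l c * deletionFoldProduct l c i = foldProduct l i := by
  rw [deletionFoldProduct, Finset.erase_right_comm, foldProduct]
  exact Finset.mul_prod_erase _ _ (by simp [hi.symm])

theorem mul_deletionFoldProduct' (l : Fin m → MvPolynomial (Fin 3) K) {c i : Fin m} (hi : i ≠ c) :
    l i * deletionFoldProduct l c i = foldProduct l c :=
  Finset.mul_prod_erase _ _ (by simp [hi])

theorem mul_deletionCombination (l : Fin m → MvPolynomial (Fin 3) K) (c : Fin m) (α : Fin m → K) :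
    l c * deletionCombination l c α = ∑ k ∈ Finset.univ.erase c, C (α k) * foldProduct l k := by
  rw [deletionCombination, Finset.mul_sum]
  refine Finset.sum_congr rfl fun k hk => ?_
  rw [← mul_deletionFoldProduct l (Finset.ne_of_mem_erase hk)]
  ring

theorem sum_mul_foldProduct_eq (l : Fin m → MvPolynomial (Fin 3) K) (c : Fin m) (α : Fin m → K) :
    ∑ k, C (α k) * foldProduct l k
      = C (α c) * foldProduct l c + l c * deletionCombination l c α := by
  rw [mul_deletionCombination, ← Finset.add_sum_erase _ _ (Finset.mem_univ c)]

variable {l : Fin m → MvPolynomial (Fin 3) K} {c a b : Fin m} {α β : Fin m → K}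

/-- Coordinates of the forms `l k`, `k ≠ c`, with respect to `l a` and `l b`. -/
structure IsDeletionCoordinates (l : Fin m → MvPolynomial (Fin 3) K) (c a b : Fin m)
    (α β : Fin m → K) : Prop where
  ha : a ≠ c
  hb : b ≠ c
  hab : a ≠ b
  eq : ∀ k, k ≠ c → l k = C (α k) * l a + C (β k) * l b
  α_a : α a = 1
  α_b : α b = 0
  β_a : β a = 0
  β_b : β b = 1

theorem exists_isDeletionCoordinates (hl : IsCentralArrangement l) (hc : IsColoop l c)
    (ha : a ≠ c) (hb : b ≠ c) (hab : a ≠ b) : ∃ α β, IsDeletionCoordinates l c a b α β := by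
  have h : ∀ k, ∃ p : K × K, (k ≠ c → l k = C p.1 * l a + C p.2 * l b) ∧
      (k = a → p = (1, 0)) ∧ (k = b → p = (0, 1)) := by
    intro k
    by_cases hka : k = a
    · exact ⟨(1, 0), fun _ => by simp [hka], fun _ => rfl, fun h => absurd (hka.symm.trans h) hab⟩
    by_cases hkb : k = b
    · exact ⟨(0, 1), fun _ => by simp [hkb], fun h => absurd h hka, fun _ => rfl⟩
    by_cases hkc : k = c
    · exact ⟨0, fun h => absurd hkc h, fun h => absurd h hka, fun h => absurd h hkb⟩
    obtain ⟨x, hx⟩ := (Submodule.mem_span_range_iff_exists_fun K).mp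
      (mem_span_pair_of_isColoop hl hc ha hb hab hkc)
    refine ⟨(x 0, x 1), fun _ => ?_, fun h => absurd h hka, fun h => absurd h hkb⟩
    rw [← hx]
    simp [Fin.sum_univ_two, smul_eq_C_mul]
  choose p h1 h2 h3 using h
  exact ⟨fun k => (p k).1, fun k => (p k).2, ha, hb, hab, h1, by simp [h2 a rfl],
    by simp [h3 b rfl], by simp [h2 a rfl], by simp [h3 b rfl]⟩

namespace IsDeletionCoordinates

/-- Euler's relation for the deletion: each of the `m - 1` forms `l k` contributes `l k *
deletionFoldProduct l c k`, which is the whole product. -/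
theorem sum_eq (h : IsDeletionCoordinates l c a b α β) :
    l a * deletionCombination l c α + l b * deletionCombination l c β
      = ((m - 1 : ℕ) : MvPolynomial (Fin 3) K) * foldProduct l c := by
  rw [deletionCombination, deletionCombination, Finset.mul_sum, Finset.mul_sum,
    ← Finset.sum_add_distrib]
  rw [Finset.sum_congr rfl (g := fun _ => foldProduct l c), Finset.sum_const,
    Finset.card_erase_of_mem (Finset.mem_univ c), Finset.card_univ, Fintype.card_fin, nsmul_eq_mul]
  intro k hk
  have hk' := Finset.ne_of_mem_erase hk
  rw [← mul_deletionFoldProduct' l hk', h.eq k hk']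
  ring

theorem jacobianIdeal_eq (h : IsDeletionCoordinates l c a b α β) (hl : IsCentralArrangement l)
    (hc : IsColoop l c) :
    jacobianIdeal (definingPolynomial l) = Ideal.span (Set.range ![foldProduct l c,
      l c * deletionCombination l c α, l c * deletionCombination l c β]) := by
  have hli := linearIndependent_of_isColoop hl hc h.ha h.hb h.hab
  refine le_antisymm (Ideal.span_le.mpr ?_) (Ideal.span_le.mpr ?_)
  · rintro _ ⟨i, rfl⟩
    have h1 : pderiv i (definingPolynomial l) = pderiv i (l c) * foldProduct l c
        + (pderiv i (l a) * (l c * deletionCombination l c α)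
          + pderiv i (l b) * (l c * deletionCombination l c β)) := by
      rw [derivation_definingPolynomial, ← Finset.add_sum_erase _ _ (Finset.mem_univ c),
        mul_deletionCombination, mul_deletionCombination, Finset.mul_sum, Finset.mul_sum,
        ← Finset.sum_add_distrib]
      congr 1
      refine Finset.sum_congr rfl fun k hk => ?_
      rw [h.eq k (Finset.ne_of_mem_erase hk), map_add, pderiv_C_mul, pderiv_C_mul]
      ring
    change pderiv i (definingPolynomial l) ∈ _
    rw [h1]
    refine Ideal.add_mem _ (Ideal.mul_mem_left _ _ (Ideal.subset_span ⟨0, rfl⟩))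
      (Ideal.add_mem _ (Ideal.mul_mem_left _ _ (Ideal.subset_span ⟨1, rfl⟩))
        (Ideal.mul_mem_left _ _ (Ideal.subset_span ⟨2, rfl⟩)))
  · have key : ∀ v : Fin 3 → K, ∃ γ : Fin m → K, γ c = v 0 ∧
        (∀ k, k ≠ c → γ k = α k * v 1 + β k * v 2) ∧
        ∑ k, C (γ k) * foldProduct l k ∈ jacobianIdeal (definingPolynomial l) := by
      intro v
      obtain ⟨θ, hθ⟩ := hli.exists_linearMap_apply_eq v
      refine ⟨fun k => θ (l k), hθ 0, fun k hk => ?_,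
        sum_functional_mul_foldProduct_mem hl.isHomogeneous θ⟩
      have h1 : θ (l a) = v 1 := hθ 1
      have h2 : θ (l b) = v 2 := hθ 2
      change θ (l k) = _
      rw [h.eq k hk, ← smul_eq_C_mul, ← smul_eq_C_mul, map_add, map_smul, map_smul, h1, h2,
        smul_eq_mul, smul_eq_mul]
    have hcongr : ∀ γ γ' : Fin m → K, (∀ k, k ≠ c → γ k = γ' k) →
        deletionCombination l c γ = deletionCombination l c γ' := fun γ γ' hγ =>
      Finset.sum_congr rfl fun k hk => by rw [hγ k (Finset.ne_of_mem_erase hk)]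
    have hzero : deletionCombination l c (fun _ => 0) = 0 := by simp [deletionCombination]
    rintro _ ⟨i, rfl⟩
    fin_cases i
    · obtain ⟨γ, h0, h1, h2⟩ := key ![1, 0, 0]
      rw [sum_mul_foldProduct_eq l c, h0, hcongr γ (fun _ => 0) (by simpa using h1), hzero] at h2
      simpa using h2
    · obtain ⟨γ, h0, h1, h2⟩ := key ![0, 1, 0]
      rw [sum_mul_foldProduct_eq l c, h0, hcongr γ α (by simpa using h1)] at h2
      simpa using h2
    · obtain ⟨γ, h0, h1, h2⟩ := key ![0, 0, 1]
      rw [sum_mul_foldProduct_eq l c, h0, hcongr γ β (by simpa using h1)] at h2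
      simpa using h2

theorem isReduction (h : IsDeletionCoordinates l c a b α β) (hl : IsCentralArrangement l)
    (hc : IsColoop l c) {s t : K}
    (hst : C s * l a * deletionCombination l c α + C t * l b * deletionCombination l c β
      = foldProduct l c) :
    IsReduction (jacobianIdeal (definingPolynomial l)) (foldProductIdeal l) := by
  have hJI := jacobianIdeal_le_foldProductIdeal l
  have hJ := h.jacobianIdeal_eq hl hc
  have hJc : foldProduct l c ∈ jacobianIdeal (definingPolynomial l) := by
    rw [hJ]; exact Ideal.subset_span ⟨0, rfl⟩
  have hJα : l c * deletionCombination l c α ∈ jacobianIdeal (definingPolynomial l) := by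
    rw [hJ]; exact Ideal.subset_span ⟨1, rfl⟩
  have hJβ : l c * deletionCombination l c β ∈ jacobianIdeal (definingPolynomial l) := by
    rw [hJ]; exact Ideal.subset_span ⟨2, rfl⟩
  have hne : ∀ i j, i ≠ j → foldProduct l i * foldProduct l j ∈
      jacobianIdeal (definingPolynomial l) * foldProductIdeal l := by
    intro i j hij
    by_cases hi : i = c
    · subst hi; exact Ideal.mul_mem_mul hJc (foldProduct_mem l j)
    by_cases hj : j = c
    · subst hj; rw [mul_comm (foldProduct l i)]; exact Ideal.mul_mem_mul hJc (foldProduct_mem l i)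
    set G := ∏ k ∈ (Finset.univ.erase i).erase j, l k with hG
    have hGi : l j * G = foldProduct l i :=
      Finset.mul_prod_erase _ _ (by simp [hij.symm])
    have hGj : l i * G = foldProduct l j := by
      rw [hG, Finset.erase_right_comm]
      exact Finset.mul_prod_erase _ _ (by simp [hij])
    have hmem : ∀ k, k ≠ c → l k * G ∈ foldProductIdeal l := by
      intro k hk
      obtain ⟨x, hx⟩ := (Submodule.mem_span_range_iff_exists_fun K).mp
        (mem_span_pair_of_isColoop hl hc hi hj hij hk)
      have : l k * G = C (x 0) * foldProduct l j + C (x 1) * foldProduct l i := by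
        rw [← hx, ← hGi, ← hGj]
        simp [Fin.sum_univ_two, smul_eq_C_mul]
        ring
      rw [this]
      exact Ideal.add_mem _ (Ideal.mul_mem_left _ _ (foldProduct_mem l j))
        (Ideal.mul_mem_left _ _ (foldProduct_mem l i))
    have : foldProduct l i * foldProduct l j
        = l c * deletionCombination l c α * (C s * (l a * G))
          + l c * deletionCombination l c β * (C t * (l b * G)) := by
      have h1 : foldProduct l i * foldProduct l j = l c * foldProduct l c * G := by
        rw [mul_foldProduct, ← mul_foldProduct l i, ← hGj]; ring
      rw [h1, ← hst]; ring
    rw [this]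
    exact Ideal.add_mem _
      (Ideal.mul_mem_mul hJα (Ideal.mul_mem_left _ _ (hmem a h.ha)))
      (Ideal.mul_mem_mul hJβ (Ideal.mul_mem_left _ _ (hmem b h.hb)))
  refine ⟨hJI, 1, ?_⟩
  rw [pow_one, pow_succ, pow_one]
  refine le_antisymm (Ideal.mul_mono_left hJI) ?_
  conv_lhs => rw [foldProductIdeal_eq, Ideal.span_mul_span']
  refine Ideal.span_le.mpr ?_
  rintro _ ⟨_, ⟨i, rfl⟩, _, ⟨j, rfl⟩, rfl⟩
  by_cases hij : i = j
  · subst hij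
    -- For a square, a functional with `θ (l i) = 1` gives an element of the Jacobian ideal with
    -- leading term `foldProduct l i`; multiplied by `foldProduct l i`, its other terms are mixed
    -- products, already treated.
    obtain ⟨θ, hθ⟩ := (LinearIndependent.of_subsingleton (R := K) (v := fun _ : Unit => l i) ()
      (hl.ne_zero i)).exists_linearMap_apply_eq 1
    have h1 := Ideal.mul_mem_mul (sum_functional_mul_foldProduct_mem hl.isHomogeneous θ)
      (foldProduct_mem l i)
    rw [← Finset.add_sum_erase _ _ (Finset.mem_univ i), show θ (l i) = 1 from hθ (), map_one,
      one_mul, add_mul] at h1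
    refine (Ideal.add_mem_iff_left _ ?_).mp h1
    rw [Finset.sum_mul]
    refine Ideal.sum_mem _ fun k hk => ?_
    rw [mul_assoc]
    exact Ideal.mul_mem_left _ _ (hne k i (Finset.ne_of_mem_erase hk))
  · exact hne i j hij

/-- A common irreducible factor divides the product of the deletion, hence is associated to some `l
k`. Both coordinates of `l k` must then vanish, contradicting `l k ≠ 0`. -/
theorem isRelPrime (h : IsDeletionCoordinates l c a b α β) (hl : IsCentralArrangement l) {s t : K}
    (hst : C s * l a * deletionCombination l c α + C t * l b * deletionCombination l c β
      = foldProduct l c) :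
    IsRelPrime (deletionCombination l c α) (deletionCombination l c β) := by
  refine WfDvdMonoid.isRelPrime_of_no_irreducible_factors ?_ ?_
  · rintro ⟨h1, h2⟩
    rw [h1, h2, mul_zero, mul_zero, add_zero] at hst
    exact Finset.prod_ne_zero_iff.mpr (fun j _ => hl.ne_zero j) hst.symm
  · intro π hπ hπα hπβ
    have h1 : π ∣ foldProduct l c := by
      rw [← hst]
      exact dvd_add (hπα.mul_left _) (hπβ.mul_left _)
    obtain ⟨k, hk, hπk⟩ := (hπ.prime.dvd_finsetProd_iff _).mp h1
    have hkπ : l k ∣ π := (hπ.dvd_comm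
      (prime_of_isHomogeneous_one (hl.isHomogeneous k) (hl.ne_zero k)).irreducible).mp hπk
    have hα := coeff_eq_zero_of_dvd_sum hl hk (hkπ.trans hπα)
    have hβ := coeff_eq_zero_of_dvd_sum hl hk (hkπ.trans hπβ)
    refine hl.ne_zero k ?_
    rw [h.eq k (Finset.ne_of_mem_erase hk), hα, hβ]
    simp

theorem isMinimalReduction (h : IsDeletionCoordinates l c a b α β) (hl : IsCentralArrangement l)
    (hc : IsColoop l c) {s t : K} (hs : s ≠ 0) (ht : t ≠ 0)
    (hst : C s * l a * deletionCombination l c α + C t * l b * deletionCombination l c β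
      = foldProduct l c) :
    IsMinimalReduction (jacobianIdeal (definingPolynomial l)) (foldProductIdeal l) := by
  have hred := h.isReduction hl hc hst
  have hli := linearIndependent_of_isColoop hl hc h.ha h.hb h.hab
  have hhom : ∀ i, (![l c, l a, l b] i).IsHomogeneous 1 := by
    simp [Fin.forall_fin_succ, hl.isHomogeneous]
  have hX := X_mem_span_of_linearIndependent hhom hli
  have hw := prime_of_isHomogeneous_one (hl.isHomogeneous c) (hl.ne_zero c)
  have hnd : ∀ k, k ≠ c → ¬ l c ∣ l k := fun k hk =>
    not_dvd_of_linearIndependent (hl.isHomogeneous c) (hl.isHomogeneous k)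
      (hl.pairwise_independent c k hk.symm)
  have hCC : ∀ r : K, r ≠ 0 → (C r * C r⁻¹ : MvPolynomial (Fin 3) K) = 1 := fun r hr => by
    rw [← map_mul, mul_inv_cancel₀ hr, map_one]
  -- The triple lemma is applied with `x = s * l a`, `y = t * l b`; nonzero `s` and `t` keep `w, x,
  -- y` a coordinate system.
  have hlt : IsOfLinearType ![C s * l a * deletionCombination l c α
      + C t * l b * deletionCombination l c β,
      l c * deletionCombination l c α, l c * deletionCombination l c β] := by
    refine isOfLinearType_triple hw ?_ ?_ ?_ ?_ ?_
    · intro hdvd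
      refine hnd b h.hb ?_
      have := hdvd.mul_left (C t⁻¹)
      rwa [← mul_assoc, mul_comm (C t⁻¹), hCC t ht, one_mul] at this
    · intro u v huv
      obtain ⟨d, hd⟩ := exists_dvd_sub_of_dvd_sub (hl.isHomogeneous a) (hl.isHomogeneous b)
        (hl.isHomogeneous c) hli hX (c := C s * u) (e := C t * v) (by convert huv using 1; ring)
      refine ⟨C t⁻¹ * C s⁻¹ * d, ?_⟩
      have := hd.mul_left (C s⁻¹)
      convert this using 1
      linear_combination -u * hCC s hs - C s⁻¹ * l b * d * hCC t ht
    · rw [hst]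
      intro hdvd
      obtain ⟨k, hk, hck⟩ := (hw.dvd_finsetProd_iff _).mp hdvd
      exact hnd k (Finset.ne_of_mem_erase hk) hck
    · intro h0
      have := coeff_eq_zero_of_dvd_sum hl (S := Finset.univ.erase c) (i := a) (γ := α)
        (by simp [h.ha]) (by
          change l a ∣ deletionCombination l c α
          rw [h0]; exact dvd_zero _)
      rw [h.α_a] at this
      exact one_ne_zero this
    · exact fun u hu => (h.isRelPrime hl hst).dvd_of_dvd_mul_left hu
  rw [hst] at hlt
  rw [h.jacobianIdeal_eq hl hc] at hred ⊢
  exact hlt.isMinimalReduction hred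

end IsDeletionCoordinates

end Coloop

/-! ### Assembly by the size of the arrangement -/

open MvPolynomial in
theorem isMinimalReduction_of_three_le {K : Type*} [Field K] [Infinite K] {m : ℕ} (hm : 3 ≤ m)
    {l : Fin m → MvPolynomial (Fin 3) K} (hl : IsCentralArrangement l)
    (hchar : 4 ≤ m → (m : K) - 1 ≠ 0) {c : Fin m} (hc : IsColoop l c) :
    IsMinimalReduction (jacobianIdeal (definingPolynomial l)) (foldProductIdeal l) := by
  obtain ⟨a, ha, b, hb, hab⟩ := Finset.one_lt_card.mp
    (show 1 < (Finset.univ.erase c).card by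
      rw [Finset.card_erase_of_mem (Finset.mem_univ c), Finset.card_univ, Fintype.card_fin]; omega)
  obtain ⟨α, β, h⟩ := exists_isDeletionCoordinates hl hc (Finset.ne_of_mem_erase ha)
    (Finset.ne_of_mem_erase hb) hab
  rcases hm.lt_or_eq with hm | rfl
  · have h1 := hchar hm
    refine h.isMinimalReduction hl hc (inv_ne_zero h1) (inv_ne_zero h1) ?_
    have h2 : (C ((m : K) - 1)⁻¹ * ((m - 1 : ℕ) : MvPolynomial (Fin 3) K)) = 1 := by
      rw [← map_natCast (C : K →+* MvPolynomial (Fin 3) K), ← map_mul, Nat.cast_sub (by omega),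
        Nat.cast_one, inv_mul_cancel₀ h1, map_one]
    linear_combination C ((m : K) - 1)⁻¹ * h.sum_eq + foldProduct l c * h2
  -- For `m = 3` the weights `1 / 2` are unavailable in characteristic 2. The deletion has product
  -- `l a * l b`, so both Euler terms equal it, and `s`, `1 - s` with `s ∉ {0, 1}` serve instead.
  · obtain ⟨s, hs⟩ := Set.Finite.exists_notMem (Set.toFinite ({0, 1} : Set K))
    simp only [Set.mem_insert_iff, Set.mem_singleton_iff, not_or] at hs
    refine h.isMinimalReduction hl hc hs.1 (sub_ne_zero.mpr (Ne.symm hs.2)) ?_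
    have hS : Finset.univ.erase c = {a, b} := by
      refine (Finset.eq_of_subset_of_card_le ?_ ?_).symm
      · simp [Finset.insert_subset_iff, h.ha, h.hb]
      · rw [Finset.card_pair hab, Finset.card_erase_of_mem (Finset.mem_univ c)]; simp
    have hα : l a * deletionCombination l c α = foldProduct l c := by
      rw [deletionCombination, hS, Finset.sum_pair hab, h.α_a, h.α_b,
        ← mul_deletionFoldProduct' l h.ha]
      simp
    have hβ : l b * deletionCombination l c β = foldProduct l c := by
      rw [deletionCombination, hS, Finset.sum_pair hab, h.β_a, h.β_b,
        ← mul_deletionFoldProduct' l h.hb]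
      simp
    rw [mul_assoc, mul_assoc, hα, hβ, map_sub, map_one]
    ring

theorem isMinimalReduction_of_size_one {K : Type*} [Field K]
    {l : Fin 1 → MvPolynomial (Fin 3) K} (hl : IsCentralArrangement l) :
    IsMinimalReduction (jacobianIdeal (definingPolynomial l)) (foldProductIdeal l) := by
  rw [jacobianIdeal_eq_of_linearIndependent hl.isHomogeneous
    (LinearIndependent.of_subsingleton 0 (hl.ne_zero 0))]
  refine ⟨IsReduction.refl _, fun L ⟨_, r, hr⟩ _ => ?_⟩
  -- The only fold product is the empty one.
  have h : foldProductIdeal l = ⊤ :=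
    (Ideal.eq_top_iff_one _).mpr (by simpa [foldProduct] using foldProduct_mem l 0)
  simp only [h, Ideal.top_pow, Ideal.mul_top] at hr
  rw [hr]
  exact le_top

theorem isMinimalReduction_of_size_two {K : Type*} [Field K]
    {l : Fin 2 → MvPolynomial (Fin 3) K} (hl : IsCentralArrangement l) :
    IsMinimalReduction (jacobianIdeal (definingPolynomial l)) (foldProductIdeal l) := by
  have hli : LinearIndependent K ![l 1, l 0] := hl.pairwise_independent 1 0 (by simp)
  have hp := prime_of_isHomogeneous_one (hl.isHomogeneous 1) (hl.ne_zero 1)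
  have hnd := not_dvd_of_linearIndependent (hl.isHomogeneous 1) (hl.isHomogeneous 0) hli
  have hI : foldProductIdeal l = Ideal.span (Set.range ![l 1, l 0]) := by
    rw [foldProductIdeal_eq]
    congr 2
    funext i
    fin_cases i
    · simp [foldProduct, show (Finset.univ : Finset (Fin 2)).erase 0 = {1} from rfl]
    · simp [foldProduct, show (Finset.univ : Finset (Fin 2)).erase 1 = {0} from rfl]
  rw [jacobianIdeal_eq_of_linearIndependent hl.isHomogeneous
    (by convert hl.pairwise_independent 0 1 (by simp) using 1; funext i; fin_cases i <;> rfl), hI]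
  exact (isOfLinearType_pair hp.ne_zero fun u hu =>
    (hp.dvd_or_dvd hu).resolve_left hnd).isMinimalReduction (IsReduction.refl _)

theorem corollary2p7 {K : Type*} [Field K] [Infinite K] (m : ℕ)
    (l : Fin m → MvPolynomial (Fin 3) K) (hl : IsCentralArrangement l)
    (hchar : (m : K) ≠ 0) (hchar' : 4 ≤ m → (m : K) - 1 ≠ 0)
    (hcoloop : ∃ i, IsColoop l i) :
    IsMinimalReduction (jacobianIdeal (definingPolynomial l)) (foldProductIdeal l) := by
  obtain ⟨c, hc⟩ := hcoloop
  match m, l, hl, hchar, hchar', c, hc with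
  | 0, _, _, _, _, c, _ => exact c.elim0
  | 1, _, hl, _, _, _, _ => exact isMinimalReduction_of_size_one hl
  | 2, _, hl, _, _, _, _ => exact isMinimalReduction_of_size_two hl
  | m + 3, _, hl, _, hchar', _, hc =>
    exact isMinimalReduction_of_three_le (by omega) hl hchar' hc
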